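/- Let $G$ be any graph (simple, undirected, of arbitrary cardinality, not necessarily connected). Then $G$ has a tree-decomposition $(T,(P_t)_{t\in V(T)})$ of finite adhesion such that the ends of $T$ define precisely the topological ends of $G$. That is: in every end of $T$ there lives exactly one vertex end of $G$, this vertex end is a topological end, and every topological end of $G$ lives in some end of $T$. Here the terms have the following meaning. A *vertex end* of $G$ is an equivalence class of rays (one-way infinite paths), where two rays are equivalent if no finite set of vertices separates them in $G$. The ends of the tree $T$ are its vertex ends. A vertex $v$ *dominates* a vertex end $\omega$ if for some ray $R$ belonging to $\omega$ there are infinitely many $v$–$R$-paths that pairwise meet only in $v$. The *topological ends* of $G$ are the vertex ends that are dominated by no vertex. A *tree-decomposition* $(T,(P_t)_{t\in V(T)})$ of $G$ consists of a tree $T$ and subgraphs $P_t$ of $G$ such that every vertex of $G$ lies in some $P_t$, every edge of $G$ lies in precisely one $P_t$, and whenever a vertex lies in $P_t$ and in $P_w$, it lies in $P_s$ for every node $s$ on the $t$–$w$-path in $T$. It has *finite adhesion* if $V(P_t)\cap V(P_u)$ is finite for every edge $tu$ of $T$. For a directed edge $tu$ of $T$, the *separation corresponding to $tu$* is the set of edges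 of $G$ contained in parts $P_w$ with $w$ in the component of $T-t$ that contains $u$. A vertex end *lives in* an edge set $X$ if some ray belonging to it has all its vertices among the vertices incident with edges of $X$; an end of $T$ *lives in* a component of $T-t$ if some ray belonging to it has all its vertices in that component. Let $O(\omega)$ be the set of directed edges $tu$ of $T$ such that $\omega$ lives in the separation corresponding to $tu$. A vertex end $\omega$ of $G$ *lives in* an end $\tau$ of $T$ if $O(\omega)$ points towards $\tau$, that is, $O(\omega)$ consists of precisely those directed edges $tu$ of $T$ for which $\tau$ lives in the component of $T-t$ containing $u$. -/

import Mathlib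

universe u v

namespace TopologicalEnds

/-- A ray of `G`: a one-way infinite path, written as the sequence of its vertices. -/
structure Ray {V : Type u} (G : SimpleGraph V) where
  toFun : ℕ → V
  injective : Function.Injective toFun
  adj : ∀ n, G.Adj (toFun n) (toFun (n + 1))

namespace Ray

variable {V : Type u} {G : SimpleGraph V}

instance : CoeFun (Ray G) (fun _ => ℕ → V) := ⟨Ray.toFun⟩

/-- Two rays are equivalent if no finite vertex set `S` separates them, that is, for every
finite `S` some walk of `G` from a vertex of `R` to a vertex of `R'` avoids `S`. -/
def Equivalent (R R' : Ray G) : Prop :=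
  ∀ S : Finset V, ∃ i j : ℕ, ∃ p : G.Walk (R i) (R' j), ∀ x ∈ p.support, x ∉ S

/-- A finite set misses all but finitely many vertices of a ray. -/
theorem exists_tail_avoids (R : Ray G) (S : Finset V) : ∃ n, ∀ m, n ≤ m → R m ∉ S := by
  classical
  have hfin : (R.toFun ⁻¹' (S : Set V)).Finite :=
    S.finite_toSet.preimage R.injective.injOn
  obtain ⟨b, hb⟩ := hfin.bddAbove
  refine ⟨b + 1, fun m hm h => ?_⟩
  have : m ≤ b := hb (show R m ∈ (S : Set V) from h)
  omega

/-- The walk along a ray from its vertex number `n` to its vertex number `n + k`. -/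
theorem exists_walk_add (R : Ray G) (n k : ℕ) :
    ∃ p : G.Walk (R n) (R (n + k)), ∀ x ∈ p.support, ∃ m, n ≤ m ∧ x = R m := by
  induction k with
  | zero =>
    refine ⟨SimpleGraph.Walk.nil, fun x hx => ⟨n, le_rfl, ?_⟩⟩
    simpa using hx
  | succ k ih =>
    obtain ⟨p, hp⟩ := ih
    refine ⟨p.concat (R.adj (n + k)), fun x hx => ?_⟩
    rw [SimpleGraph.Walk.support_concat, List.mem_append] at hx
    rcases hx with hx | hx
    · exact hp x hx
    · exact ⟨n + (k + 1), by omega, by simpa using hx⟩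

/-- Any two vertices of a tail of a ray are joined by a walk within that tail. -/
theorem exists_walk_tail (R : Ray G) (n i j : ℕ) (hi : n ≤ i) (hj : n ≤ j) :
    ∃ p : G.Walk (R i) (R j), ∀ x ∈ p.support, ∃ m, n ≤ m ∧ x = R m := by
  rcases le_total i j with h | h
  · obtain ⟨k, rfl⟩ := Nat.exists_eq_add_of_le h
    obtain ⟨p, hp⟩ := R.exists_walk_add i k
    refine ⟨p, fun x hx => ?_⟩
    obtain ⟨m, hm, e⟩ := hp x hx
    exact ⟨m, hi.trans hm, e⟩
  · obtain ⟨k, rfl⟩ := Nat.exists_eq_add_of_le h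
    obtain ⟨p, hp⟩ := R.exists_walk_add j k
    refine ⟨p.reverse, fun x hx => ?_⟩
    rw [SimpleGraph.Walk.support_reverse, List.mem_reverse] at hx
    obtain ⟨m, hm, e⟩ := hp x hx
    exact ⟨m, hj.trans hm, e⟩

theorem Equivalent.refl (R : Ray G) : R.Equivalent R := by
  intro S
  obtain ⟨n, hn⟩ := R.exists_tail_avoids S
  refine ⟨n, n, SimpleGraph.Walk.nil, fun x hx => ?_⟩
  have hx' : x = R n := by simpa using hx
  rw [hx']
  exact hn n le_rfl

theorem Equivalent.symm {R R' : Ray G} (h : R.Equivalent R') : R'.Equivalent R := by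
  intro S
  obtain ⟨i, j, p, hp⟩ := h S
  refine ⟨j, i, p.reverse, fun x hx => hp x ?_⟩
  rwa [SimpleGraph.Walk.support_reverse, List.mem_reverse] at hx

theorem Equivalent.trans {R R' R'' : Ray G} (h : R.Equivalent R') (h' : R'.Equivalent R'') :
    R.Equivalent R'' := by
  classical
  intro S
  obtain ⟨n, hn⟩ := R'.exists_tail_avoids S
  -- enlarge `S` by the initial segment of `R'` in which it meets `R'`
  let S' : Finset V := S ∪ (Finset.range n).image R'.toFun
  have hS' : ∀ x, x ∉ S' → x ∉ S := fun x hx hxS => hx (Finset.mem_union_left _ hxS)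
  have hge : ∀ j, R' j ∉ S' → n ≤ j := by
    intro j hj
    by_contra hlt
    exact hj (Finset.mem_union_right _
      (Finset.mem_image_of_mem _ (Finset.mem_range.2 (not_le.1 hlt))))
  obtain ⟨i, j, p, hp⟩ := h S'
  obtain ⟨k, l, q, hq⟩ := h' S'
  have hj : n ≤ j := hge j (hp _ p.end_mem_support)
  have hk : n ≤ k := hge k (hq _ q.start_mem_support)
  obtain ⟨r, hr⟩ := R'.exists_walk_tail n j k hj hk
  refine ⟨i, l, (p.append r).append q, fun x hx => ?_⟩
  rw [SimpleGraph.Walk.mem_support_append_iff, SimpleGraph.Walk.mem_support_append_iff] at hx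
  rcases hx with (hx | hx) | hx
  · exact hS' x (hp x hx)
  · obtain ⟨m, hm, rfl⟩ := hr x hx
    exact hn m hm
  · exact hS' x (hq x hx)

end Ray

/-- Equivalence of rays, as a setoid. -/
instance raySetoid {V : Type u} (G : SimpleGraph V) : Setoid (Ray G) where
  r := Ray.Equivalent
  iseqv := ⟨Ray.Equivalent.refl, Ray.Equivalent.symm, Ray.Equivalent.trans⟩

/-- A vertex end of `G`: an equivalence class of rays. -/
def VertexEnd {V : Type u} (G : SimpleGraph V) : Type u := Quotient (raySetoid G)

/-- The ray `R` belongs to the vertex end `ω`. -/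
def Ray.BelongsTo {V : Type u} {G : SimpleGraph V} (R : Ray G) (ω : VertexEnd G) : Prop :=
  Quotient.mk (raySetoid G) R = ω

/-- The vertex `x` dominates the vertex end `ω`: for some ray `R` belonging to `ω` there are
infinitely many `x`-`R`-paths (paths from `x` to a vertex of `R`, with no other vertex on `R`)
which pairwise meet only in `x`. -/
def Dominates {V : Type u} {G : SimpleGraph V} (x : V) (ω : VertexEnd G) : Prop :=
  ∃ R : Ray G, R.BelongsTo ω ∧
    ∃ (f : ℕ → ℕ) (P : ∀ n, G.Walk x (R (f n))),
      Function.Injective f ∧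
      (∀ n, (P n).IsPath) ∧
      (∀ n m, R m ∈ (P n).support → m = f n) ∧
      (∀ m n, m ≠ n → ∀ y, y ∈ (P m).support → y ∈ (P n).support → y = x)

/-- The topological ends of `G`: the vertex ends that are dominated by no vertex. -/
def topologicalEnds {V : Type u} (G : SimpleGraph V) : Set (VertexEnd G) :=
  {ω | ∀ x : V, ¬ Dominates x ω}

/-- The vertices incident with an edge of the edge set `X`. -/
def vertsOf {V : Type u} (X : Set (Sym2 V)) : Set V := {x | ∃ e ∈ X, x ∈ e}

/-- The vertex end `ω` lives in the vertex set `A`: some ray belonging to `ω` has all its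
vertices in `A`. -/
def VertexEnd.LivesIn {V : Type u} {G : SimpleGraph V} (ω : VertexEnd G) (A : Set V) : Prop :=
  ∃ R : Ray G, R.BelongsTo ω ∧ ∀ n, R n ∈ A

/-- For a directed edge `d = tu` of `T`, the vertex set of the component of `T - t` that
contains `u`. -/
def sideOf {N : Type v} {T : SimpleGraph N} (d : T.Dart) : Set N :=
  {w | ∃ p : T.Walk d.snd w, d.fst ∉ p.support}

/-- A tree-decomposition of `G` with decomposition tree `T`. -/
structure TreeDecomposition {V : Type u} (G : SimpleGraph V) {N : Type v}
    (T : SimpleGraph N) where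
  isTree : T.IsTree
  part : N → G.Subgraph
  exists_mem_part : ∀ x : V, ∃ t, x ∈ (part t).verts
  existsUnique_edge_part : ∀ e ∈ G.edgeSet, ∃! t, e ∈ (part t).edgeSet
  mem_part_of_mem_path : ∀ (x : V) (t w : N) (p : T.Walk t w), p.IsPath →
    x ∈ (part t).verts → x ∈ (part w).verts → ∀ s ∈ p.support, x ∈ (part s).verts

namespace TreeDecomposition

variable {V : Type u} {G : SimpleGraph V} {N : Type v} {T : SimpleGraph N}

/-- Adjacent parts have only finitely many common vertices. -/
def FiniteAdhesion (D : TreeDecomposition G T) : Prop :=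
  ∀ t s : N, T.Adj t s → ((D.part t).verts ∩ (D.part s).verts).Finite

/-- The separation (edge set of `G`) corresponding to the directed edge `d = tu` of `T`: the
edges contained in the parts of the nodes in the component of `T - t` containing `u`. -/
def separation (D : TreeDecomposition G T) (d : T.Dart) : Set (Sym2 V) :=
  {e | ∃ w ∈ sideOf d, e ∈ (D.part w).edgeSet}

/-- The set `O(ω)` of the directed edges of `T` such that `ω` lives in the corresponding
separation. -/
def orientation (D : TreeDecomposition G T) (ω : VertexEnd G) : Set T.Dart :=
  {d | ω.LivesIn (vertsOf (D.separation d))}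

/-- The vertex end `ω` of `G` lives in the end `τ` of `T`: the orientation `O(ω)` points
towards `τ`, that is, it consists of those directed edges `tu` of `T` for which `τ` lives in
the component of `T - t` containing `u`. -/
def LivesInEnd (D : TreeDecomposition G T) (ω : VertexEnd G) (τ : VertexEnd T) : Prop :=
  ∀ d : T.Dart, d ∈ D.orientation ω ↔ τ.LivesIn (sideOf d)

/-- The ends of `T` define precisely the set `W` of vertex ends of `G`: in every end of `T`
there lives a unique vertex end of `G` and it is in `W`, and every vertex end in `W` lives in
some end of `T`. -/
def EndsDefinePrecisely (D : TreeDecomposition G T) (W : Set (VertexEnd G)) : Prop :=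
  (∀ τ : VertexEnd T, (∃! ω : VertexEnd G, D.LivesInEnd ω τ) ∧
    ∀ ω : VertexEnd G, D.LivesInEnd ω τ → ω ∈ W) ∧
  ∀ ω ∈ W, ∃ τ : VertexEnd T, D.LivesInEnd ω τ

end TreeDecomposition

end TopologicalEnds

/-! Say that an end is in the closure of a vertex set if no finite set separates its rays from that
set (`Ray.Clings`). It suffices to exhaust `G` by increasing sets `A n` such that the components of
each `G - A n` have finite neighbourhoods, all neighbours of `A n` lie in `A (n + 1)`, and no
undominated end is in the closure of any `A n`. The components of all the `G - A n`, below a root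
and ordered by level and inclusion, then form the tree. An undominated end selects one component at
each level, hence an end of the tree. Conversely, an end of the tree is a descending sequence of
components. The star-comb lemma `exists_star_or_comb` finds an end of `G` in it; this end is unique
because the components eventually avoid every finite set, and undominated because every vertex
eventually lies outside the component and its finite boundary.

The sets `A n` arise by alternately adding neighbours and taking envelopes. Adding neighbours
captures no undominated end (`not_clings_bdry`). The envelope of `exists_envelope` adds a maximal
family of disjoint rays of ends in the closure, then all vertices that no finite set separates from
the result. This puts no new end in the closure, and a remaining component with infinite
neighbourhood would, by the star-comb lemma, contain such a vertex or such a ray. -/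

namespace TopologicalEnds

/-! ### Walks avoiding a set, boundaries and components -/

section Linked

variable {V : Type u} {G : SimpleGraph V}

/-- Some walk from `x` to `y` avoids `S`. -/
def Linked (G : SimpleGraph V) (S : Set V) (x y : V) : Prop :=
  ∃ p : G.Walk x y, ∀ z ∈ p.support, z ∉ S

theorem Linked.refl {S : Set V} {x : V} (h : x ∉ S) : Linked G S x x :=
  ⟨.nil, by simpa using h⟩

theorem Linked.symm {S : Set V} {x y : V} (h : Linked G S x y) : Linked G S y x := by
  obtain ⟨p, hp⟩ := h
  exact ⟨p.reverse, by simpa using hp⟩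

theorem Linked.trans {S : Set V} {x y z : V} (h : Linked G S x y) (h' : Linked G S y z) :
    Linked G S x z := by
  obtain ⟨p, hp⟩ := h
  obtain ⟨q, hq⟩ := h'
  refine ⟨p.append q, fun w hw => ?_⟩
  rw [SimpleGraph.Walk.mem_support_append_iff] at hw
  exact hw.elim (hp w) (hq w)

theorem Linked.mono {S S' : Set V} {x y : V} (h : Linked G S' x y) (hS : S ⊆ S') :
    Linked G S x y := by
  obtain ⟨p, hp⟩ := h
  exact ⟨p, fun z hz hzS => hp z hz (hS hzS)⟩

theorem Linked.left {S : Set V} {x y : V} (h : Linked G S x y) : x ∉ S := by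
  obtain ⟨p, hp⟩ := h
  exact hp _ p.start_mem_support

theorem Linked.right {S : Set V} {x y : V} (h : Linked G S x y) : y ∉ S := h.symm.left

theorem Linked.of_adj {S : Set V} {x y : V} (h : G.Adj x y) (hx : x ∉ S) (hy : y ∉ S) :
    Linked G S x y := by
  refine ⟨h.toWalk, fun z hz => ?_⟩
  simp only [SimpleGraph.Adj.toWalk, SimpleGraph.Walk.support_cons,
    SimpleGraph.Walk.support_nil, List.mem_cons, List.not_mem_nil, or_false] at hz
  rcases hz with rfl | rfl <;> assumption

/-- The vertices outside `D` with a neighbour in `D`. -/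
def bdry (G : SimpleGraph V) (D : Set V) : Set V := {a | a ∉ D ∧ ∃ c ∈ D, G.Adj c a}

/-- A walk can leave `D` only through its boundary. This is how boundaries are exploited throughout,
both in `G` and in the tree. -/
theorem Linked.mem_of_bdry {D S : Set V} {x y : V} (h : Linked G S x y) (hS : bdry G D ⊆ S)
    (hx : x ∈ D) : y ∈ D := by
  obtain ⟨p, hp⟩ := h
  induction p with
  | nil => exact hx
  | @cons a b c hab p ih =>
    refine ih ?_ (fun z hz => hp z (by simp [hz]))
    by_contra hb
    exact hp b (by simp) (hS ⟨hb, a, hx, hab⟩)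

/-- Any two vertices of `C` are joined by a walk in `C`. -/
def ConnectedSet (G : SimpleGraph V) (C : Set V) : Prop :=
  ∀ x ∈ C, ∀ y ∈ C, Linked G Cᶜ x y

theorem ConnectedSet.induce {C : Set V} (hC : ConnectedSet G C) (hne : C.Nonempty) :
    (G.induce C).Connected := by
  have key : ∀ {x y : V} (p : G.Walk x y) (hp : ∀ z ∈ p.support, z ∈ C),
      (G.induce C).Reachable ⟨x, hp _ p.start_mem_support⟩ ⟨y, hp _ p.end_mem_support⟩ := by
    intro x y p
    induction p with
    | nil => intro hp; exact .refl _
    | @cons a b c hab p ih =>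
      intro hp
      refine SimpleGraph.Reachable.trans (SimpleGraph.Adj.reachable ?_)
        (ih fun z hz => hp z (by simp [hz]))
      simpa using hab
  have : Nonempty C := hne.to_subtype
  refine ⟨fun x y => ?_⟩
  obtain ⟨p, hp⟩ := hC x x.2 y y.2
  exact key p fun z hz => not_not.1 (hp z hz)

/-- The vertices that can be reached from `x` in `G - A`. -/
def comp (G : SimpleGraph V) (A : Set V) (x : V) : Set V := {y | Linked G A x y}

theorem connectedSet_comp (A : Set V) (x : V) : ConnectedSet G (comp G A x) := by
  classical
  have key : ∀ y, Linked G A x y → Linked G (comp G A x)ᶜ x y := by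
    rintro y ⟨p, hp⟩
    refine ⟨p, fun z hz hzc => hzc ⟨p.takeUntil z hz, fun w hw => hp w ?_⟩⟩
    exact p.support_takeUntil_subset_support hz hw
  exact fun y hy z hz => (key y hy).symm.trans (key z hz)

theorem bdry_comp_subset (A : Set V) (x : V) : bdry G (comp G A x) ⊆ A := by
  rintro a ⟨ha, c, hc, hca⟩
  by_contra h
  exact ha (Linked.trans hc (.of_adj hca (Linked.right hc) h))

end Linked

/-! ### The star-comb lemma -/

section StarComb

/-- A vertex on a geodesic splits its length. -/
theorem dist_add_dist_of_mem_geodesic {W : Type u} {H : SimpleGraph W} {x y z : W}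
    (p : H.Walk x y) (hp : p.length = H.dist x y) (hz : z ∈ p.support) (hH : H.Connected) :
    H.dist x z + H.dist z y = H.dist x y := by
  classical
  have h1 := congrArg SimpleGraph.Walk.length (p.take_spec hz)
  rw [SimpleGraph.Walk.length_append] at h1
  have h2 := SimpleGraph.dist_le (p.takeUntil z hz)
  have h3 := SimpleGraph.dist_le (p.dropUntil z hz)
  have h4 := hH.dist_triangle (u := x) (v := z) (w := y)
  omega

/-- A connected graph containing an infinite family of vertices has a vertex or a ray that
cannot be separated from infinitely many of them by a finite set. -/
theorem exists_star_or_comb {W : Type u} {H : SimpleGraph W} (hH : H.Connected) {ι : Type v}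
    [Infinite ι] (f : ι → W) :
    (∃ x, ∀ (X : Set W) (I : Set ι), X.Finite → I.Finite → x ∉ X →
      ∃ i ∉ I, Linked H X x (f i)) ∨
    ∃ R : Ray H, ∀ (X : Set W) (I : Set ι), X.Finite → I.Finite →
      ∃ n, ∃ i ∉ I, Linked H X (R n) (f i) := by
  classical
  obtain ⟨v⟩ := hH.nonempty
  -- The indices `i` for which some geodesic from `v` to `f i` passes through `x`.
  let S : W → Set ι := fun x => {i | H.dist v (f i) = H.dist v x + H.dist x (f i)}
  have tri : ∀ a b c, H.dist a c ≤ H.dist a b + H.dist b c := fun a b c => hH.dist_triangle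
  have hSv : (S v).Infinite := by
    have : S v = Set.univ := by ext i; simp [S]
    rw [this]; exact Set.infinite_univ
  -- vertices on a geodesic from `x` to `f i`, where `i ∈ S x`
  have geo : ∀ x, ∀ i ∈ S x, ∃ p : H.Walk x (f i), ∀ z ∈ p.support,
      H.dist v z = H.dist v x + H.dist x z ∧ i ∈ S z := by
    intro x i hi
    obtain ⟨p, hp⟩ := hH.exists_walk_length_eq_dist x (f i)
    refine ⟨p, fun z hz => ?_⟩
    have h1 := dist_add_dist_of_mem_geodesic p hp hz hH
    have h2 := tri v z (f i)
    have h3 := tri v x z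
    simp only [S, Set.mem_ofPred_eq] at hi ⊢
    omega
  -- Follow vertices with `S x` infinite away from `v`. Getting stuck at `x` gives a star centred at
  -- `x`; never getting stuck gives a geodesic ray, the spine of a comb.
  by_cases hx : ∃ x, (S x).Infinite ∧
      ∀ y, H.Adj x y → H.dist v y = H.dist v x + 1 → (S y).Finite
  · left
    obtain ⟨x, hxi, hxc⟩ := hx
    refine ⟨x, fun X I hX hI hxX => ?_⟩
    -- A vertex `z` beyond `x` lies behind some child `y` of `x`, and then `S z ⊆ S y`. So a finite
    -- `X` missing `x` blocks only finitely many of the geodesics leaving `x`.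
    have hfin : ∀ z, H.dist v z = H.dist v x + H.dist x z → z ≠ x → (S z).Finite := by
      intro z hz hzx
      obtain ⟨p, hp⟩ := hH.exists_walk_length_eq_dist x z
      cases p with
      | nil => exact absurd rfl hzx
      | @cons _ y _ hxy p =>
        have h1 : H.dist y z ≤ p.length := SimpleGraph.dist_le p
        have h2 : H.dist x y ≤ 1 := SimpleGraph.dist_le hxy.toWalk
        have h3 := tri x y z
        have h4 := tri v x y
        have h5 := tri v y z
        rw [SimpleGraph.Walk.length_cons] at hp
        refine (hxc y hxy (by omega)).subset fun i hi => ?_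
        have h6 := tri y z (f i)
        have h7 := tri v y (f i)
        simp only [S, Set.mem_ofPred_eq] at hi ⊢
        omega
    have hbad : (I ∪ ⋃ z ∈ {z ∈ X | H.dist v z = H.dist v x + H.dist x z}, S z).Finite := by
      refine hI.union (Set.Finite.biUnion (hX.subset (Set.sep_subset _ _)) fun z hz => ?_)
      exact hfin z hz.2 fun h => hxX (h ▸ hz.1)
    obtain ⟨i, hi, hib⟩ := (hxi.sdiff hbad).nonempty
    obtain ⟨p, hp⟩ := geo x i hi
    refine ⟨i, fun h => hib (.inl h), p, fun z hz hzX => hib (.inr ?_)⟩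
    simp only [Set.mem_iUnion]
    exact ⟨z, ⟨hzX, (hp z hz).1⟩, (hp z hz).2⟩
  · right
    push Not at hx
    choose! g hg using hx
    let r : ℕ → W := fun n => g^[n] v
    have hr : ∀ n, r (n + 1) = g (r n) := fun n => Function.iterate_succ_apply' g n v
    have hinf : ∀ n, (S (r n)).Infinite := by
      intro n
      induction n with
      | zero => exact hSv
      | succ n ih => rw [hr]; exact (hg _ ih).2.2
    have hdist : ∀ n, H.dist v (r n) = n := by
      intro n
      induction n with
      | zero => simp [r]
      | succ n ih => rw [hr, (hg _ (hinf n)).2.1, ih]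
    refine ⟨⟨r, fun a b h => ?_, fun n => ?_⟩, fun X I hX hI => ?_⟩
    · rw [← hdist a, ← hdist b, h]
    · rw [hr]; exact (hg _ (hinf n)).1
    -- All of `X` is within distance `m` of `v`, whereas a geodesic continuing outwards from `r (m +
    -- 1)` stays farther away.
    · obtain ⟨m, hm⟩ := (hX.image (H.dist v)).bddAbove
      obtain ⟨i, hi, hiI⟩ := ((hinf (m + 1)).sdiff hI).nonempty
      obtain ⟨p, hp⟩ := geo _ i hi
      refine ⟨m + 1, i, hiI, p, fun z hz hzX => ?_⟩
      have h1 := hm (Set.mem_image_of_mem _ hzX)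
      have h2 := (hp z hz).1
      have h3 := hdist (m + 1)
      omega

theorem Linked.of_induce {V : Type u} {G : SimpleGraph V} {C X : Set V} {x y : C}
    (h : Linked (G.induce C) (Subtype.val ⁻¹' X) x y) : Linked G X x y := by
  obtain ⟨p, hp⟩ := h
  induction p with
  | nil => exact .refl (hp _ (by simp))
  | @cons a b c hab p ih =>
    have hab' : G.Adj a b := hab
    exact (Linked.of_adj hab' (hp a (by simp)) (hp b (by simp))).trans
      (ih fun z hz => hp z (by simp [hz]))

/-- `exists_star_or_comb` within a connected set of vertices. -/
theorem ConnectedSet.exists_star_or_comb {V : Type u} {G : SimpleGraph V} {C : Set V}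
    (hC : ConnectedSet G C) {ι : Type v} [Infinite ι] (f : ι → V) (hf : ∀ i, f i ∈ C) :
    (∃ x ∈ C, ∀ (X : Set V) (I : Set ι), X.Finite → I.Finite → x ∉ X →
      ∃ i ∉ I, Linked G X x (f i)) ∨
    ∃ R : Ray G, (∀ n, R n ∈ C) ∧ ∀ (X : Set V) (I : Set ι), X.Finite → I.Finite →
      ∃ n, ∃ i ∉ I, Linked G X (R n) (f i) := by
  obtain ⟨i₀⟩ : Nonempty ι := inferInstance
  have pre : ∀ X : Set V, X.Finite → (Subtype.val ⁻¹' X : Set C).Finite := fun X hX =>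
    hX.preimage Subtype.val_injective.injOn
  rcases TopologicalEnds.exists_star_or_comb (hC.induce ⟨_, hf i₀⟩)
    (fun i => (⟨f i, hf i⟩ : C)) with ⟨x, hx⟩ | ⟨R, hR⟩
  · refine .inl ⟨x, x.2, fun X I hX hI hxX => ?_⟩
    obtain ⟨i, hi, h⟩ := hx _ I (pre X hX) hI hxX
    exact ⟨i, hi, h.of_induce⟩
  · refine .inr ⟨⟨fun n => R n, fun a b h => R.injective (Subtype.ext h),
      fun n => R.adj n⟩, fun n => (R n).2, fun X I hX hI => ?_⟩
    obtain ⟨n, i, hi, h⟩ := hR _ I (pre X hX) hI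
    exact ⟨n, i, hi, h.of_induce⟩

end StarComb

/-! ### Ends in the closure of a vertex set, and envelopes -/

section Rays

variable {V : Type u} {G : SimpleGraph V}

namespace Ray

theorem exists_tail {S : Set V} (R : Ray G) (hS : S.Finite) : ∃ n, ∀ m, n ≤ m → R m ∉ S := by
  obtain ⟨n, hn⟩ := R.exists_tail_avoids hS.toFinset
  exact ⟨n, fun m hm h => hn m hm (by simpa using h)⟩

theorem linked_of_tail {S : Set V} {R : Ray G} {n : ℕ} (hn : ∀ m, n ≤ m → R m ∉ S) {i j : ℕ}
    (hi : n ≤ i) (hj : n ≤ j) : Linked G S (R i) (R j) := by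
  obtain ⟨p, hp⟩ := R.exists_walk_tail n i j hi hj
  refine ⟨p, fun z hz => ?_⟩
  obtain ⟨m, hm, rfl⟩ := hp z hz
  exact hn m hm

theorem equivalent_iff {R R' : Ray G} :
    R.Equivalent R' ↔ ∀ S : Set V, S.Finite → ∃ i j, Linked G S (R i) (R' j) := by
  refine ⟨fun h S hS => ?_, fun h S => ?_⟩
  · obtain ⟨i, j, p, hp⟩ := h hS.toFinset
    exact ⟨i, j, p, by simpa using hp⟩
  · obtain ⟨i, j, p, hp⟩ := h S S.finite_toSet
    exact ⟨i, j, p, by simpa using hp⟩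

/-- The first `n` vertices of a ray. -/
def initial (R : Ray G) (n : ℕ) : Set V := R.toFun '' Set.Iio n

theorem finite_initial (R : Ray G) (n : ℕ) : (R.initial n).Finite :=
  (Set.finite_Iio n).image _

theorem le_of_notMem_initial {R : Ray G} {n i : ℕ} (h : R i ∉ R.initial n) : n ≤ i :=
  not_lt.1 fun hi => h ⟨i, hi, rfl⟩

/-- The ray starting at vertex number `n`. -/
def drop (R : Ray G) (n : ℕ) : Ray G where
  toFun i := R (n + i)
  injective _ _ h := Nat.add_left_cancel (R.injective h)
  adj i := R.adj (n + i)

theorem equivalent_drop (R : Ray G) (n : ℕ) : R.Equivalent (R.drop n) := by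
  refine equivalent_iff.2 fun S hS => ?_
  obtain ⟨m, hm⟩ := R.exists_tail hS
  exact ⟨m, m, linked_of_tail hm le_rfl (Nat.le_add_left m n)⟩

/-- The ray `R` cannot be separated from `B` by a finite set: its end is in the closure
of `B`. -/
def Clings (R : Ray G) (B : Set V) : Prop :=
  ∀ S : Set V, S.Finite → ∃ i, ∃ b ∈ B, Linked G S (R i) b

theorem Clings.exists_ge {R : Ray G} {B : Set V} (h : R.Clings B) (n : ℕ) {S : Set V}
    (hS : S.Finite) : ∃ i, n ≤ i ∧ ∃ b ∈ B, Linked G S (R i) b := by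
  obtain ⟨i, b, hb, hl⟩ := h _ (hS.union (R.finite_initial n))
  exact ⟨i, le_of_notMem_initial fun h => hl.left (.inr h), b, hb,
    hl.mono Set.subset_union_left⟩

theorem not_clings_iff {R : Ray G} {B : Set V} :
    ¬ R.Clings B ↔ ∃ S : Set V, S.Finite ∧ ∃ n, (∀ m, n ≤ m → R m ∉ S) ∧
      ∀ i, n ≤ i → ∀ b ∈ B, ¬ Linked G S (R i) b := by
  refine ⟨fun h => ?_, fun ⟨S, hS, n, hn, hB⟩ h => ?_⟩
  · simp only [Clings] at h
    push Not at h
    obtain ⟨S, hS, h⟩ := h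
    obtain ⟨n, hn⟩ := R.exists_tail hS
    exact ⟨S, hS, n, hn, fun i _ => h i⟩
  · obtain ⟨i, hi, b, hb, hl⟩ := h.exists_ge n hS
    exact hB i hi b hb hl

theorem not_clings_union {R : Ray G} {B C : Set V} (hB : ¬ R.Clings B) (hC : ¬ R.Clings C) :
    ¬ R.Clings (B ∪ C) := by
  obtain ⟨S, hS, n, -, h⟩ := not_clings_iff.1 hB
  obtain ⟨S', hS', n', -, h'⟩ := not_clings_iff.1 hC
  intro hcl
  obtain ⟨i, hi, b, hb, hl⟩ := hcl.exists_ge (max n n') (hS.union hS')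
  rcases hb with hb | hb
  · exact h i (by omega) b hb (hl.mono Set.subset_union_left)
  · exact h' i (by omega) b hb (hl.mono Set.subset_union_right)

end Ray

open Ray

/-- The set of all vertices that no finite set separates from `A`. -/
def fanClosure (G : SimpleGraph V) (A : Set V) : Set V :=
  {x | ∀ S : Set V, S.Finite → x ∉ S → ∃ a ∈ A, Linked G S x a}

theorem subset_fanClosure (A : Set V) : A ⊆ fanClosure G A :=
  fun x hx _ _ hxS => ⟨x, hx, .refl hxS⟩

theorem clings_of_clings_fanClosure {R : Ray G} {A : Set V} (h : R.Clings (fanClosure G A)) :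
    R.Clings A := by
  intro S hS
  obtain ⟨i, a, ha, hl⟩ := h S hS
  obtain ⟨b, hb, hl'⟩ := ha S hS hl.right
  exact ⟨i, b, hb, hl.trans hl'⟩

/-- A walk reaching a ray of `F` can be continued along a tail of that ray and on to `B`.
Disjointness ensures that a finite set disturbs only finitely many of these rays. -/
theorem clings_of_clings_union_rays {B : Set V} {F : Set (Ray G)}
    (hF : ∀ Q ∈ F, Q.Clings B) (hd : F.PairwiseDisjoint fun Q => Set.range Q.toFun)
    {R : Ray G} (h : R.Clings (B ∪ ⋃ Q ∈ F, Set.range Q.toFun)) : R.Clings B := by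
  by_contra hR
  obtain ⟨S, hS, n, hn, hB⟩ := not_clings_iff.1 hR
  choose q hq using fun Q : Ray G => Q.exists_tail hS
  have hsep : ∀ Q ∈ F, ∀ m, (∀ j, m ≤ j → Q j ∉ S) → ∀ i j, n ≤ i → m ≤ j →
      ¬ Linked G S (R i) (Q j) := by
    intro Q hQ m hm i j hi hj hl
    obtain ⟨k, hk, b, hb, hl'⟩ := (hF Q hQ).exists_ge m hS
    exact hB i hi b hb ((hl.trans (linked_of_tail hm hj hk)).trans hl')
  -- The rays of `F` that meet `S`, at most one for each vertex of `S`. Deleting their initial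
  -- segments as well forces any walk to such a ray to end in a tail avoiding `S`.
  let F' : Set (Ray G) := ⋃ s ∈ S, {Q ∈ F | s ∈ Set.range Q.toFun}
  have hF' : F'.Finite := by
    refine Set.Finite.biUnion hS fun s _ => Set.Subsingleton.finite ?_
    intro Q hQ Q' hQ'
    by_contra hne
    exact Set.disjoint_left.1 (hd hQ.1 hQ'.1 hne) hQ.2 hQ'.2
  have hS' : (S ∪ ⋃ Q ∈ F', Q.initial (q Q)).Finite :=
    hS.union (Set.Finite.biUnion hF' fun Q _ => Q.finite_initial _)
  obtain ⟨i, hi, a, ha, hl⟩ := h.exists_ge n hS'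
  rcases ha with ha | ha
  · exact hB i hi a ha (hl.mono Set.subset_union_left)
  · simp only [Set.mem_iUnion] at ha
    obtain ⟨Q, hQ, j, rfl⟩ := ha
    by_cases hQF : Q ∈ F'
    · refine hsep Q hQ (q Q) (hq Q) i j hi ?_ (hl.mono Set.subset_union_left)
      refine le_of_notMem_initial (R := Q) fun hj => hl.right (.inr ?_)
      simp only [Set.mem_iUnion]
      exact ⟨Q, hQF, hj⟩
    · refine hsep Q hQ 0 (fun k _ hk => hQF ?_) i j hi (Nat.zero_le _)
        (hl.mono Set.subset_union_left)
      simp only [F', Set.mem_iUnion]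
      exact ⟨_, hk, hQ, k, rfl⟩

theorem exists_maximal_disjoint_rays (G : SimpleGraph V) (B : Set V) :
    ∃ F : Set (Ray G), (∀ Q ∈ F, Q.Clings B) ∧
      (F.PairwiseDisjoint fun Q => Set.range Q.toFun) ∧
      ∀ R : Ray G, R.Clings B → ∃ Q ∈ F, ∃ i j, R i = Q j := by
  obtain ⟨F, hF⟩ := zorn_subset {F : Set (Ray G) | (∀ Q ∈ F, Q.Clings B) ∧
      F.PairwiseDisjoint fun Q => Set.range Q.toFun} (by
    intro c hc hchain
    refine ⟨⋃₀ c, ⟨fun Q ⟨F, hF, hQ⟩ => (hc hF).1 Q hQ, ?_⟩, fun F hF => Set.subset_sUnion_of_mem hF⟩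
    exact (Set.pairwiseDisjoint_sUnion hchain.directedOn).2 fun F hF => (hc hF).2)
  refine ⟨F, hF.prop.1, hF.prop.2, fun R hR => ?_⟩
  by_contra! hdis
  have hRF : R ∈ F := by
    refine hF.le_of_ge (y := insert R F) ⟨?_, ?_⟩ (Set.subset_insert _ _) (Set.mem_insert _ _)
    · rintro Q (rfl | hQ)
      exacts [hR, hF.prop.1 Q hQ]
    · refine hF.prop.2.insert fun Q hQ _ => Set.disjoint_left.2 ?_
      rintro _ ⟨i, rfl⟩ ⟨j, hj⟩
      exact hdis Q hQ i j hj.symm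
  exact hdis R hRF 0 0 rfl

/-- Each vertex set is contained in one which has the same ends in its closure and all of whose
complementary components have finite neighbourhoods. -/
theorem exists_envelope (G : SimpleGraph V) (B : Set V) :
    ∃ A, B ⊆ A ∧ (∀ x ∉ A, (bdry G (comp G A x)).Finite) ∧
      ∀ R : Ray G, R.Clings A → R.Clings B := by
  obtain ⟨F, hF, hd, hmax⟩ := exists_maximal_disjoint_rays G B
  set A₁ := B ∪ ⋃ Q ∈ F, Set.range Q.toFun with hA₁
  have hcl : ∀ R : Ray G, R.Clings (fanClosure G A₁) → R.Clings B := fun R hR =>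
    clings_of_clings_union_rays hF hd (clings_of_clings_fanClosure hR)
  refine ⟨fanClosure G A₁, Set.subset_union_left.trans (subset_fanClosure _), fun x hx => ?_, hcl⟩
  set A := fanClosure G A₁ with hA
  by_contra hinf
  have : Infinite (bdry G (comp G A x)) := Set.infinite_coe_iff.2 hinf
  choose f hf hfa using fun a : bdry G (comp G A x) => a.2.2
  -- Here `f` picks a neighbour inside the component for each boundary vertex. The centre of a star
  -- would already be in the fan closure; the spine of a comb would meet a ray of the maximal
  -- family. Both contradict lying outside `A`.
  rcases (connectedSet_comp A x).exists_star_or_comb f hf with ⟨y, hy, h⟩ | ⟨R, hR, h⟩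
  · refine Linked.right hy fun S hS hyS => ?_
    obtain ⟨a, ha, hl⟩ := h S (Subtype.val ⁻¹' S) hS
      (hS.preimage Subtype.val_injective.injOn) hyS
    obtain ⟨b, hb, hl'⟩ := bdry_comp_subset _ _ a.2 S hS ha
    exact ⟨b, hb, (hl.trans (.of_adj (hfa a) hl.right ha)).trans hl'⟩
  · have hRA : R.Clings A := by
      intro S hS
      obtain ⟨n, i, hi, hl⟩ := h S (Subtype.val ⁻¹' S) hS
        (hS.preimage Subtype.val_injective.injOn)
      exact ⟨n, i, bdry_comp_subset _ _ i.2, hl.trans (.of_adj (hfa i) hl.right hi)⟩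
    obtain ⟨Q, hQ, i, j, hij⟩ := hmax R (hcl R hRA)
    refine Linked.right (hR i) (subset_fanClosure _ (.inr ?_))
    simp only [Set.mem_iUnion]
    exact ⟨Q, hQ, j, hij.symm⟩

end Rays

/-! ### Ends living in sets with finite boundary, and domination -/

section Ends

variable {V : Type u} {G : SimpleGraph V}

open Ray

theorem Ray.BelongsTo.equivalent {R R' : Ray G} {ω : VertexEnd G} (h : R.BelongsTo ω)
    (h' : R'.BelongsTo ω) : R.Equivalent R' :=
  Quotient.exact (s := raySetoid G) (h.trans h'.symm)

theorem Ray.BelongsTo.of_equivalent {R R' : Ray G} {ω : VertexEnd G} (h : R.BelongsTo ω)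
    (h' : R.Equivalent R') : R'.BelongsTo ω :=
  (Quotient.sound (s := raySetoid G) h').symm.trans h

theorem VertexEnd.exists_ray (ω : VertexEnd G) : ∃ R : Ray G, R.BelongsTo ω :=
  Quotient.exists_rep ω

theorem Ray.Equivalent.exists_ge {R R' : Ray G} (h : R.Equivalent R') {S : Set V}
    (hS : S.Finite) (n m : ℕ) : ∃ i j, n ≤ i ∧ m ≤ j ∧ Linked G S (R i) (R' j) := by
  obtain ⟨i, j, hl⟩ := equivalent_iff.1 h _
    ((hS.union (R.finite_initial n)).union (R'.finite_initial m))
  exact ⟨i, j, le_of_notMem_initial fun h => hl.left (.inl (.inr h)),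
    le_of_notMem_initial fun h => hl.right (.inr h),
    hl.mono (Set.subset_union_left.trans Set.subset_union_left)⟩

theorem Ray.tail_mem {D : Set V} (R : Ray G) {k n : ℕ} (hn : ∀ m, n ≤ m → R m ∉ bdry G D)
    (hk : n ≤ k) (hkD : R k ∈ D) : ∀ m, n ≤ m → R m ∈ D := fun _ hm =>
  (linked_of_tail hn hk hm).mem_of_bdry subset_rfl hkD

/-- Beyond the finite boundary a ray stays on one side of it, and equivalent rays stay on the same
side. So any ray of `ω` can serve as a test. -/
theorem VertexEnd.livesIn_iff {D : Set V} (hD : (bdry G D).Finite) {ω : VertexEnd G}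
    {R : Ray G} (hR : R.BelongsTo ω) : ω.LivesIn D ↔ ∃ n, ∀ m, n ≤ m → R m ∈ D := by
  constructor
  · rintro ⟨Q, hQ, hQD⟩
    obtain ⟨n, hn⟩ := R.exists_tail hD
    obtain ⟨i, j, -, hj, hl⟩ := (hQ.equivalent hR).exists_ge hD 0 n
    exact ⟨n, R.tail_mem hn hj (hl.mem_of_bdry subset_rfl (hQD i))⟩
  · rintro ⟨n, hn⟩
    exact ⟨R.drop n, hR.of_equivalent (R.equivalent_drop n), fun m => hn _ (Nat.le_add_right n m)⟩

theorem VertexEnd.livesIn_compl {D : Set V} (hD : (bdry G D).Finite) (ω : VertexEnd G) :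
    ω.LivesIn Dᶜ ↔ ¬ ω.LivesIn D := by
  constructor
  · rintro ⟨R, hR, hRD⟩ h
    obtain ⟨n, hn⟩ := (livesIn_iff hD hR).1 h
    exact hRD n (hn n le_rfl)
  · intro h
    obtain ⟨R, hR⟩ := ω.exists_ray
    obtain ⟨n, hn⟩ := R.exists_tail hD
    refine ⟨R.drop n, hR.of_equivalent (R.equivalent_drop n), fun m hm => h ?_⟩
    exact (livesIn_iff hD hR).2 ⟨n, R.tail_mem hn (Nat.le_add_right n m) hm⟩

theorem VertexEnd.LivesIn.mono {ω : VertexEnd G} {A B : Set V} (h : ω.LivesIn A) (hAB : A ⊆ B) :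
    ω.LivesIn B := by
  obtain ⟨R, hR, hRA⟩ := h
  exact ⟨R, hR, fun n => hAB (hRA n)⟩

theorem VertexEnd.LivesIn.inter_nonempty {ω : VertexEnd G} {A B : Set V} (h : ω.LivesIn A)
    (h' : ω.LivesIn B) (hB : (bdry G B).Finite) : (A ∩ B).Nonempty := by
  obtain ⟨R, hR, hRA⟩ := h
  obtain ⟨n, hn⟩ := (livesIn_iff hB hR).1 h'
  exact ⟨R n, hRA n, hn n le_rfl⟩

/-- A vertex off the ray `R` that no finite set separates from `R` sends an infinite fan
to `R`. -/
theorem dominates_of_linked {ω : VertexEnd G} {R : Ray G} (hR : R.BelongsTo ω) {x : V}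
    (hx : ∀ n, R n ≠ x) (h : ∀ S : Set V, S.Finite → x ∉ S → ∃ i, Linked G S x (R i)) :
    Dominates x ω := by
  classical
  have path : ∀ S : Set V, S.Finite → x ∉ S → ∃ (i : ℕ) (p : G.Walk x (R i)),
      p.IsPath ∧ (∀ m, R m ∈ p.support → m = i) ∧ ∀ z ∈ p.support, z ∉ S := by
    intro S hS hxS
    -- A shortest walk to the ray avoiding `S` meets the ray only in its last vertex.
    have hex : ∃ l, ∃ (i : ℕ) (p : G.Walk x (R i)), p.length = l ∧ ∀ z ∈ p.support, z ∉ S := by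
      obtain ⟨i, p, hp⟩ := h S hS hxS
      exact ⟨_, i, p, rfl, hp⟩
    obtain ⟨i, p, hl, hp⟩ := Nat.find_spec hex
    have hmin : ∀ (j : ℕ) (q : G.Walk x (R j)), (∀ z ∈ q.support, z ∉ S) →
        p.length ≤ q.length := fun j q hq => hl ▸ Nat.find_min' hex ⟨j, q, rfl, hq⟩
    refine ⟨i, p.bypass, p.bypass_isPath, fun m hm => ?_,
      fun z hz => hp z (p.support_bypass_subset_support hz)⟩
    have hm' := p.support_bypass_subset_support hm
    have h1 := hmin m (p.takeUntil _ hm') fun z hz =>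
      hp z (p.support_takeUntil_subset_support hm' hz)
    have h2 := congrArg SimpleGraph.Walk.length (p.take_spec hm')
    rw [SimpleGraph.Walk.length_append] at h2
    exact R.injective (SimpleGraph.Walk.eq_of_length_eq_zero (p := p.dropUntil _ hm') (by omega))
  obtain ⟨f, hf, hff⟩ := exists_seq_of_forall_finset_exists
    (fun a : Σ i, G.Walk x (R i) => a.2.IsPath ∧ ∀ m, R m ∈ a.2.support → m = a.1)
    (fun a b => ∀ z ∈ a.2.support, z ∈ b.2.support → z = x) (fun s _ => by
      obtain ⟨i, p, hp, hpR, hps⟩ := path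
        (⋃ a ∈ s, {z | z ∈ a.2.support ∧ z ≠ x})
        (Set.Finite.biUnion s.finite_toSet fun a _ =>
          a.2.support.finite_toSet.subset fun z hz => hz.1) (by simp)
      refine ⟨⟨i, p⟩, ⟨hp, hpR⟩, fun a ha z hz hzp => ?_⟩
      by_contra hzx
      refine hps z hzp ?_
      simp only [Set.mem_iUnion]
      exact ⟨a, ha, hz, hzx⟩)
  have hdis : ∀ m n, m ≠ n → ∀ y, y ∈ (f m).2.support → y ∈ (f n).2.support → y = x := by
    intro m n hmn y hm hn
    rcases lt_or_gt_of_ne hmn with h | h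
    · exact hff m n h y hm hn
    · exact hff n m h y hn hm
  refine ⟨R, hR, fun n => (f n).1, fun n => (f n).2, fun m n hmn => ?_, fun n => (hf n).1,
    fun n => (hf n).2, hdis⟩
  by_contra hne
  refine hx _ (hdis m n hne _ (f m).2.end_mem_support ?_)
  dsimp only at hmn
  rw [hmn]
  exact (f n).2.end_mem_support

/-- A vertex not dominating an end is separated from it by some finite set not containing
the vertex. -/
theorem exists_separator_of_not_dominates {ω : VertexEnd G} {R : Ray G} (hR : R.BelongsTo ω)
    {x : V} (hx : ¬ Dominates x ω) :
    ∃ S : Set V, S.Finite ∧ x ∉ S ∧ ∃ n, ∀ i, n ≤ i → ¬ Linked G S x (R i) := by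
  obtain ⟨n, hn⟩ := R.exists_tail (Set.finite_singleton x)
  have hR' := hR.of_equivalent (R.equivalent_drop n)
  have h := mt (dominates_of_linked hR' fun m => hn _ (Nat.le_add_right n m)) hx
  push Not at h
  obtain ⟨S, hS, hxS, h⟩ := h
  refine ⟨S, hS, hxS, n, fun i hi => ?_⟩
  obtain ⟨k, rfl⟩ := Nat.exists_eq_add_of_le hi
  exact h k

theorem not_clings_singleton_of_not_dominates {ω : VertexEnd G} {R : Ray G} (hR : R.BelongsTo ω)
    {x : V} (hx : ¬ Dominates x ω) : ¬ R.Clings {x} := by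
  obtain ⟨S, hS, -, n, h⟩ := exists_separator_of_not_dominates hR hx
  intro hcl
  obtain ⟨i, hi, b, rfl, hl⟩ := hcl.exists_ge n hS
  exact h i hi hl.symm

/-- If an undominated end is not in the closure of `B`, it is not in the closure of the
neighbourhood of `B`. -/
theorem not_clings_bdry {ω : VertexEnd G} {R : Ray G} (hR : R.BelongsTo ω)
    (hω : ω ∈ topologicalEnds G) {B : Set V} (hB : ¬ R.Clings B) : ¬ R.Clings (bdry G B) := by
  obtain ⟨S, hS, n, hn, hSB⟩ := not_clings_iff.1 hB
  -- Delete `S` and the separators `X s` of all `s ∈ S`. A walk from far out on `R` to a neighbour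
  -- of `b ∈ B` then extends to `b`, avoiding `S` if `b ∉ S` and avoiding `X b` if `b ∈ S`; neither
  -- is possible.
  choose X hX hxX m hm using fun x => exists_separator_of_not_dominates hR (hω x)
  obtain ⟨M, hM⟩ := (hS.image m).bddAbove
  intro hcl
  obtain ⟨i, hi, a, ⟨-, b, hb, hba⟩, hl⟩ := hcl.exists_ge (max n M)
    (hS.union (hS.biUnion fun x _ => hX x))
  have hlS := hl.mono Set.subset_union_left
  by_cases hbS : b ∈ S
  · have hlX : Linked G (X b) (R i) a :=
      hl.mono fun z hz => .inr (Set.mem_biUnion hbS hz)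
    refine hm b i ?_ ((Linked.of_adj hba (hxX b) hlX.right).trans hlX.symm)
    exact (hM (Set.mem_image_of_mem m hbS)).trans ((le_max_right _ _).trans hi)
  · exact hSB i (by omega) b hb (hlS.trans (.of_adj hba.symm hlS.right hbS))

/-- A vertex outside `D` and its finite boundary dominates no end in `D`. -/
theorem not_dominates_of_livesIn {ω : VertexEnd G} {D : Set V} (hD : (bdry G D).Finite)
    (hω : ω.LivesIn D) {x : V} (hx : x ∉ D) (hx' : x ∉ bdry G D) : ¬ Dominates x ω := by
  rintro ⟨R, hR, f, P, hf, -, -, hdis⟩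
  obtain ⟨n, hn⟩ := (VertexEnd.livesIn_iff hD hR).1 hω
  have : Nonempty V := ⟨x⟩
  have hmeet : ∀ k, n ≤ f k → ∃ y ∈ (P k).support, y ∈ bdry G D := by
    intro k hk
    by_contra! hno
    exact hx (Linked.mem_of_bdry ⟨(P k).reverse, by simpa using hno⟩ subset_rfl (hn _ hk))
  have hinf : {k | n ≤ f k}.Infinite := by
    have hfin : {k | f k < n}.Finite := (Set.finite_Iio n).preimage hf.injOn
    refine hfin.infinite_compl.mono fun k hk => ?_
    simpa using hk
  choose! y hy hyD using hmeet
  -- Infinitely many paths of the fan cross the finite boundary, so two cross it in the same vertex,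
  -- which can only be `x`.
  obtain ⟨k, hk, l, hl, hne, heq⟩ :=
    hinf.exists_ne_map_eq_of_mapsTo (f := y) (t := bdry G D) (fun k hk => hyD k hk) hD
  exact hx' (hdis k l hne (y k) (hy k hk) (heq ▸ hy l hl) ▸ hyD k hk)

end Ends

/-! ### The tree of components of an exhaustion -/

/-- An increasing sequence of vertex sets exhausting `G`, all of whose complementary components
have finite neighbourhoods. -/
structure IsExhaustion {V : Type u} (G : SimpleGraph V) (A : ℕ → Set V) : Prop where
  mono : Monotone A
  exhaust : ∀ x, ∃ n, x ∈ A n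
  finite_bdry : ∀ n, ∀ x ∉ A n, (bdry G (comp G (A n) x)).Finite

/-- The vertex sets which, together with the level `n`, are the nodes of the tree: at level `0`
just the whole vertex set, at level `n + 1` the components of `G - A n`. -/
def IsNode {V : Type u} (G : SimpleGraph V) (A : ℕ → Set V) : ℕ → Set V → Prop
  | 0, D => D = Set.univ
  | n + 1, D => ∃ x ∉ A n, D = comp G (A n) x

/-- The nodes of the tree of components of an exhaustion. -/
abbrev Node {V : Type u} (G : SimpleGraph V) (A : ℕ → Set V) : Type u :=
  {p : ℕ × Set V // IsNode G A p.1 p.2}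

section Nodes

variable {V : Type u} {G : SimpleGraph V} {A : ℕ → Set V}

namespace Node

/-- The level of a node. -/
abbrev level (t : Node G A) : ℕ := t.1.1

/-- The vertex set of a node. -/
abbrev set (t : Node G A) : Set V := t.1.2

theorem ext' {t u : Node G A} (h : t.level = u.level) (h' : t.set = u.set) : t = u :=
  Subtype.ext (Prod.ext h h')

/-- The root of the tree. -/
def root : Node G A := ⟨(0, Set.univ), rfl⟩

theorem set_eq_univ {t : Node G A} (h : t.level = 0) : t.set = Set.univ := by
  obtain ⟨⟨n, D⟩, ht⟩ := t
  obtain rfl : n = 0 := h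
  exact ht

theorem eq_root {t : Node G A} (h : t.level = 0) : t = root := ext' h (set_eq_univ h)

theorem exists_eq_comp {t : Node G A} {n : ℕ} (h : t.level = n + 1) :
    ∃ x ∉ A n, t.set = comp G (A n) x := by
  obtain ⟨⟨m, D⟩, ht⟩ := t
  obtain rfl : m = n + 1 := h
  exact ht

theorem set_nonempty {t : Node G A} {n : ℕ} (h : t.level = n + 1) : t.set.Nonempty := by
  obtain ⟨x, hx, he⟩ := exists_eq_comp h
  exact ⟨x, he ▸ Linked.refl hx⟩

theorem connectedSet {t : Node G A} {n : ℕ} (h : t.level = n + 1) : ConnectedSet G t.set := by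
  obtain ⟨x, hx, he⟩ := exists_eq_comp h
  rw [he]
  exact connectedSet_comp _ _

theorem finite_bdry (hA : IsExhaustion G A) (t : Node G A) : (bdry G t.set).Finite := by
  rcases h : t.level with _ | n
  · rw [set_eq_univ h]
    exact Set.finite_empty.subset fun x hx => hx.1 trivial
  · obtain ⟨x, hx, he⟩ := exists_eq_comp h
    rw [he]
    exact hA.finite_bdry n x hx

theorem level_le (hA : IsExhaustion G A) {t : Node G A} {x : V} (hx : x ∈ t.set) {k : ℕ}
    (hk : x ∈ A k) : t.level ≤ k := by
  rcases h : t.level with _ | n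
  · exact Nat.zero_le _
  · obtain ⟨y, hy, he⟩ := exists_eq_comp h
    rw [he] at hx
    by_contra hlt
    exact hx.right (hA.mono (by omega) hk)

theorem exists_lt_of_mem_bdry {t : Node G A} {x : V} (hx : x ∈ bdry G t.set) :
    ∃ k < t.level, x ∈ A k := by
  rcases h : t.level with _ | n
  · rw [set_eq_univ h] at hx
    exact absurd trivial hx.1
  · obtain ⟨y, hy, he⟩ := exists_eq_comp h
    rw [he] at hx
    exact ⟨n, Nat.lt_succ_self n, bdry_comp_subset _ _ hx⟩

theorem mem_of_adj {t : Node G A} {x y : V} (hx : x ∈ t.set) (hxy : G.Adj x y)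
    (hy : ∀ k, y ∈ A k → t.level ≤ k) : y ∈ t.set := by
  by_contra hyt
  obtain ⟨k, hk, hyk⟩ := exists_lt_of_mem_bdry ⟨hyt, x, hx, hxy⟩
  exact absurd (hy k hyk) (not_le.2 hk)

theorem subset_of_mem (hA : IsExhaustion G A) {t u : Node G A} (h : t.level ≤ u.level) {x : V}
    (ht : x ∈ t.set) (hu : x ∈ u.set) : u.set ⊆ t.set := by
  rcases hn : t.level with _ | n
  · rw [set_eq_univ hn]
    exact Set.subset_univ _
  · obtain ⟨m, hm⟩ : ∃ m, u.level = m + 1 := ⟨u.level - 1, by omega⟩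
    obtain ⟨y, -, he⟩ := exists_eq_comp hn
    obtain ⟨z, -, he'⟩ := exists_eq_comp hm
    rw [he] at ht ⊢
    rw [he'] at hu ⊢
    intro w hw
    exact Linked.trans ht ((Linked.trans (Linked.symm hu) hw).mono (hA.mono (by omega)))

theorem exists_mem {x : V} {n : ℕ} (h : ∀ k, x ∈ A k → n ≤ k) :
    ∃ t : Node G A, t.level = n ∧ x ∈ t.set := by
  cases n with
  | zero => exact ⟨root, rfl, trivial⟩
  | succ n =>
    have hx : x ∉ A n := fun hx => absurd (h n hx) (by omega)
    exact ⟨⟨(n + 1, comp G (A n) x), x, hx, rfl⟩, rfl, .refl hx⟩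

/-- `t` is an ancestor of `u`, or `u` itself. -/
def Below (t u : Node G A) : Prop := t.level ≤ u.level ∧ u.set ⊆ t.set

theorem Below.refl (t : Node G A) : Below t t := ⟨le_rfl, subset_rfl⟩

theorem Below.trans {t u w : Node G A} (h : Below t u) (h' : Below u w) : Below t w :=
  ⟨h.1.trans h'.1, h'.2.trans h.2⟩

theorem Below.antisymm {t u : Node G A} (h : Below t u) (h' : Below u t) : t = u :=
  ext' (le_antisymm h.1 h'.1) (Set.Subset.antisymm h'.2 h.2)

theorem below_root (t : Node G A) : Below root t := ⟨Nat.zero_le _, Set.subset_univ _⟩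

theorem Below.of_mem (hA : IsExhaustion G A) {t u : Node G A} (h : t.level ≤ u.level) {x : V}
    (ht : x ∈ t.set) (hu : x ∈ u.set) : Below t u := ⟨h, subset_of_mem hA h ht hu⟩

/-- The ancestors of a node form a chain, since components sharing a vertex are nested. Level `0` is
treated apart because the root's set may be empty. -/
theorem Below.total (hA : IsExhaustion G A) {t u w : Node G A} (h : Below t w) (h' : Below u w)
    (hl : t.level ≤ u.level) : Below t u := by
  rcases hw : w.level with _ | n
  · have := h'.1
    rw [eq_root (t := t) (by omega)]
    exact below_root u
  · obtain ⟨x, hx⟩ := set_nonempty hw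
    exact .of_mem hA hl (h.2 hx) (h'.2 hx)

theorem Below.eq_of_level_eq (hA : IsExhaustion G A) {t u w : Node G A} (h : Below t w)
    (h' : Below u w) (hl : t.level = u.level) : t = u :=
  (h.total hA h' hl.le).antisymm (h'.total hA h hl.ge)

theorem exists_parent (hA : IsExhaustion G A) {u : Node G A} {n : ℕ} (h : u.level = n + 1) :
    ∃ t : Node G A, t.level = n ∧ Below t u := by
  obtain ⟨x, hx⟩ := set_nonempty h
  obtain ⟨t, ht, hxt⟩ := exists_mem (G := G) (A := A) (x := x) (n := n)
    fun k hk => (Nat.le_succ n).trans (h.symm.le.trans (level_le hA hx hk))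
  exact ⟨t, ht, .of_mem hA (by omega) hxt hx⟩

end Node

open Node

/-- The tree of components of an exhaustion. -/
def nodeTree (G : SimpleGraph V) (A : ℕ → Set V) : SimpleGraph (Node G A) where
  Adj t u := (u.level = t.level + 1 ∧ Below t u) ∨ (t.level = u.level + 1 ∧ Below u t)
  symm := ⟨fun _ _ h => h.symm⟩
  loopless := ⟨fun _ h => by rcases h with h | h <;> exact absurd h.1 (by omega)⟩

/-- The nodes above `u`, including `u`. -/
def upset (u : Node G A) : Set (Node G A) := {w | Below u w}

/-- The only edge leaving the up-set of `u` joins `u` to its parent. Acyclicity, the sides of tree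
edges and the finite boundaries of up-sets all follow from this. -/
theorem eq_of_adj_of_mem_upset (hA : IsExhaustion G A) {u a b : Node G A}
    (hab : (nodeTree G A).Adj a b) (ha : a ∈ upset u) (hb : b ∉ upset u) :
    a = u ∧ u.level = b.level + 1 ∧ Below b u := by
  rcases hab with h | h
  · exact absurd (Below.trans ha h.2) hb
  · have hlt : b.level < u.level := by
      by_contra hlt
      exact hb (Below.total hA ha h.2 (not_lt.1 hlt))
    have hl := ha.1
    obtain rfl : a = u := (Below.refl a).eq_of_level_eq hA ha (by omega)
    exact ⟨rfl, h⟩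

theorem exists_walk_of_below (hA : IsExhaustion G A) {u : Node G A} :
    ∀ (n : ℕ) (w : Node G A), w.level = u.level + n → Below u w →
      ∃ p : (nodeTree G A).Walk u w, ∀ z ∈ p.support, Below u z ∧ Below z w := by
  intro n
  induction n with
  | zero =>
    intro w hn hw
    obtain rfl := (Below.refl w).eq_of_level_eq hA hw (by omega)
    refine ⟨.nil, fun z hz => ?_⟩
    obtain rfl : z = w := by simpa using hz
    exact ⟨hw, hw⟩
  | succ n ih =>
    intro w hn hw
    obtain ⟨t, ht, htw⟩ := exists_parent hA (n := u.level + n) hn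
    obtain ⟨p, hp⟩ := ih t ht (hw.total hA htw (by omega))
    have hadj : (nodeTree G A).Adj t w := .inl ⟨by omega, htw⟩
    refine ⟨p.concat hadj, fun z hz => ?_⟩
    rw [SimpleGraph.Walk.support_concat, List.mem_append] at hz
    rcases hz with hz | hz
    · exact ⟨(hp z hz).1, (hp z hz).2.trans htw⟩
    · obtain rfl : z = w := by simpa using hz
      exact ⟨hw, .refl z⟩

theorem Node.Below.exists_walk (hA : IsExhaustion G A) {u w : Node G A} (h : Below u w) :
    ∃ p : (nodeTree G A).Walk u w, ∀ z ∈ p.support, Below u z ∧ Below z w :=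
  exists_walk_of_below hA (w.level - u.level) w (by have := h.1; omega) h

theorem isTree_nodeTree (hA : IsExhaustion G A) : (nodeTree G A).IsTree := by
  have : Nonempty (Node G A) := ⟨root⟩
  refine ⟨⟨fun t u => ?_⟩, ?_⟩
  · obtain ⟨p, -⟩ := (below_root t).exists_walk hA
    obtain ⟨q, -⟩ := (below_root u).exists_walk hA
    exact ⟨p.reverse.append q⟩
  · have key : ∀ t u : Node G A, u.level = t.level + 1 → Below t u →
        ¬ ((nodeTree G A).deleteEdges {s(t, u)}).Reachable u t := by
      rintro t u hl htu ⟨p⟩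
      have stay : ∀ a b (q : ((nodeTree G A).deleteEdges {s(t, u)}).Walk a b),
          a ∈ upset u → b ∈ upset u := by
        intro a b q
        induction q with
        | nil => exact id
        | @cons a b c hab q ih =>
          intro ha
          refine ih ?_
          by_contra hb
          rw [SimpleGraph.deleteEdges_adj] at hab
          obtain ⟨rfl, h1, h2⟩ := eq_of_adj_of_mem_upset hA hab.1 ha hb
          obtain rfl := h2.eq_of_level_eq hA htu (by omega)
          exact hab.2 Sym2.eq_swap
      have := (stay _ _ p (Below.refl u)).1
      omega
    rw [SimpleGraph.isAcyclic_iff_forall_adj_isBridge]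
    intro t u htu
    rw [SimpleGraph.isBridge_iff]
    rcases htu with h | h
    · exact fun hr => key t u h.1 h.2 hr.symm
    · rw [Sym2.eq_swap]
      exact fun hr => key u t h.1 h.2 hr

theorem sideOf_up (hA : IsExhaustion G A) (d : (nodeTree G A).Dart)
    (hd : d.snd.level = d.fst.level + 1) : sideOf d = upset d.snd := by
  ext w
  constructor
  · intro hw
    obtain ⟨p, hp⟩ := hw
    refine Linked.mem_of_bdry (S := {d.fst}) ⟨p, fun z hz h => hp (h ▸ hz)⟩ ?_ (Below.refl d.snd)
    rintro b ⟨hb, a, ha, hab⟩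
    obtain ⟨-, h1, h2⟩ := eq_of_adj_of_mem_upset hA hab ha hb
    rcases d.adj with h | h
    · exact h2.eq_of_level_eq hA h.2 (by omega)
    · omega
  · intro hw
    obtain ⟨p, hp⟩ := Below.exists_walk hA hw
    refine ⟨p, fun h => ?_⟩
    have := (hp _ h).1.1
    omega

theorem sideOf_down (hA : IsExhaustion G A) (d : (nodeTree G A).Dart)
    (hd : d.fst.level = d.snd.level + 1) : sideOf d = (upset d.fst)ᶜ := by
  ext w
  constructor
  · rintro ⟨p, hp⟩
    refine Linked.mem_of_bdry (S := {d.fst}) ⟨p, fun z hz h => hp (h ▸ hz)⟩ ?_ fun h => ?_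
    · rintro b ⟨hb, a, ha, hab⟩
      exact (eq_of_adj_of_mem_upset hA hab.symm (not_not.1 hb) ha).1
    · have := h.1
      omega
  · intro hw
    obtain ⟨p, hp⟩ := (below_root w).exists_walk hA
    obtain ⟨q, hq⟩ := (below_root d.snd).exists_walk hA
    refine ⟨q.reverse.append p, fun h => ?_⟩
    rw [SimpleGraph.Walk.mem_support_append_iff, SimpleGraph.Walk.support_reverse,
      List.mem_reverse] at h
    rcases h with h | h
    · have := (hq _ h).2.1
      omega
    · exact hw (hp _ h).2

theorem finite_bdry_upset (hA : IsExhaustion G A) (u : Node G A) :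
    (bdry (nodeTree G A) (upset u)).Finite := by
  refine Set.Subsingleton.finite ?_
  rintro b ⟨hb, a, ha, hab⟩ b' ⟨hb', a', ha', hab'⟩
  obtain ⟨-, h1, h2⟩ := eq_of_adj_of_mem_upset hA hab ha hb
  obtain ⟨-, h1', h2'⟩ := eq_of_adj_of_mem_upset hA hab' ha' hb'
  exact h2.eq_of_level_eq hA h2' (by omega)

end Nodes

/-! ### The tree-decomposition and its separations -/

section Decomposition

variable {V : Type u} {G : SimpleGraph V} {A : ℕ → Set V}

open Node

/-- The part of a node: its component up to the next level together with its boundary, and the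
edges between these vertices that meet the component. -/
def Node.part (t : Node G A) : G.Subgraph where
  verts := t.set ∩ A t.level ∪ bdry G t.set
  Adj x y := G.Adj x y ∧ x ∈ t.set ∩ A t.level ∪ bdry G t.set ∧
    y ∈ t.set ∩ A t.level ∪ bdry G t.set ∧ (x ∈ t.set ∨ y ∈ t.set)
  adj_sub h := h.1
  edge_vert h := h.2.1
  symm := ⟨fun _ _ h => ⟨h.1.symm, h.2.2.1, h.2.1, h.2.2.2.symm⟩⟩

/-- A boundary vertex `x` of `w` has a neighbour `c` in `w`. As `x` lies in some `A k` with `k`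
below the level of `w`, the level of `u` is too low to separate `x` from `c`. -/
theorem Node.below_of_mem_part (hA : IsExhaustion G A) {u w : Node G A} {x : V}
    (hw : x ∈ w.part.verts) (hu : x ∈ u.set) : Below u w := by
  rcases hw with ⟨hw, hxA⟩ | hw
  · exact .of_mem hA (level_le hA hu hxA) hu hw
  · obtain ⟨k, hk, hxk⟩ := exists_lt_of_mem_bdry hw
    have hl : u.level ≤ w.level := (level_le hA hu hxk).trans hk.le
    obtain ⟨-, c, hc, hcx⟩ := hw
    exact .of_mem hA hl (mem_of_adj hu hcx.symm fun j hj => hl.trans (level_le hA hc hj)) hc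

theorem exists_home (hA : IsExhaustion G A) (x : V) :
    ∃ t : Node G A, x ∈ t.set ∧ x ∈ A t.level := by
  classical
  obtain ⟨t, ht, hx⟩ := exists_mem (G := G) (A := A) (x := x) (n := Nat.find (hA.exhaust x))
    fun k hk => Nat.find_min' _ hk
  exact ⟨t, hx, ht ▸ Nat.find_spec (hA.exhaust x)⟩

theorem Node.mem_part_of_adj (hA : IsExhaustion G A) {t u : Node G A} {x y : V}
    (hxy : G.Adj x y) (hxA : x ∈ A t.level) (hy : y ∈ u.set)
    (hyA : y ∈ A u.level) (hl : t.level ≤ u.level) : s(x, y) ∈ u.part.edgeSet := by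
  have hxu : x ∈ u.part.verts := by
    by_cases h : x ∈ u.set
    · exact .inl ⟨h, hA.mono hl hxA⟩
    · exact .inr ⟨h, y, hy, hxy.symm⟩
  exact ⟨hxy, hxu, .inl ⟨hy, hyA⟩, .inr hy⟩

theorem exists_edge_part (hA : IsExhaustion G A) {e : Sym2 V} (he : e ∈ G.edgeSet) :
    ∃ t : Node G A, e ∈ t.part.edgeSet := by
  induction e with
  | _ x y =>
    obtain ⟨t, ht, htA⟩ := exists_home hA x
    obtain ⟨u, hu, huA⟩ := exists_home hA y
    rcases le_total t.level u.level with h | h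
    · exact ⟨u, mem_part_of_adj hA he htA hu huA h⟩
    · exact ⟨t, Sym2.eq_swap ▸ mem_part_of_adj hA (G.symm.symm _ _ he) huA ht htA h⟩

theorem Node.exists_mem_of_mem_edgeSet {t : Node G A} {e : Sym2 V} (he : e ∈ t.part.edgeSet) :
    ∃ x ∈ e, x ∈ t.set := by
  induction e with
  | _ x y =>
    rcases (SimpleGraph.Subgraph.mem_edgeSet.1 he).2.2.2 with h | h
    · exact ⟨x, by simp, h⟩
    · exact ⟨y, by simp, h⟩

theorem Node.below_of_mem_edgeSet (hA : IsExhaustion G A) {t u : Node G A} {e : Sym2 V}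
    (he : e ∈ t.part.edgeSet) {x : V} (hx : x ∈ e) (hxu : x ∈ u.set) : Below u t :=
  below_of_mem_part hA (t.part.mem_verts_of_mem_edge he hx) hxu

/-- The tree-decomposition given by an exhaustion. -/
def treeDecomposition (hA : IsExhaustion G A) : TreeDecomposition G (nodeTree G A) where
  isTree := isTree_nodeTree hA
  part := Node.part
  exists_mem_part x := by
    obtain ⟨t, ht, htA⟩ := exists_home hA x
    exact ⟨t, .inl ⟨ht, htA⟩⟩
  existsUnique_edge_part e he := by
    obtain ⟨t, ht⟩ := exists_edge_part hA he
    refine ⟨t, ht, fun u hu => ?_⟩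
    obtain ⟨x, hx, hxt⟩ := exists_mem_of_mem_edgeSet ht
    obtain ⟨y, hy, hyu⟩ := exists_mem_of_mem_edgeSet hu
    exact (below_of_mem_edgeSet hA ht hy hyu).antisymm (below_of_mem_edgeSet hA hu hx hxt)
  mem_part_of_mem_path x t w p hp ht hw s hs := by
    classical
    -- Every part containing `x` sits above the home `h` of `x`, and `x` lies in all parts on the
    -- way up from `h`. The tree path from `t` to `w` runs inside the union of two such walks.
    obtain ⟨h, hh, hhA⟩ := exists_home hA x
    have key : ∀ u : Node G A, x ∈ u.part.verts → ∃ q : (nodeTree G A).Walk h u,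
        ∀ z ∈ q.support, x ∈ z.part.verts := by
      intro u hu
      obtain ⟨q, hq⟩ := (below_of_mem_part hA hu hh).exists_walk hA
      refine ⟨q, fun z hz => ?_⟩
      obtain ⟨hhz, hzu⟩ := hq z hz
      by_cases hxz : x ∈ z.set
      · exact .inl ⟨hxz, hA.mono hhz.1 hhA⟩
      · rcases hu with hu | ⟨-, c, hc, hcx⟩
        · exact absurd (hzu.2 hu.1) hxz
        · exact .inr ⟨hxz, c, hzu.2 hc, hcx⟩
    obtain ⟨q, hq⟩ := key t ht
    obtain ⟨r, hr⟩ := key w hw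
    have huniq := ((isTree_nodeTree hA).isAcyclic.subsingleton_path t w).elim
      ⟨p, hp⟩ ⟨(q.reverse.append r).bypass, SimpleGraph.Walk.bypass_isPath _⟩
    rw [Subtype.mk.injEq] at huniq
    rw [huniq] at hs
    have hs' := SimpleGraph.Walk.support_bypass_subset_support _ hs
    rw [SimpleGraph.Walk.mem_support_append_iff, SimpleGraph.Walk.support_reverse,
      List.mem_reverse] at hs'
    exact hs'.elim (hq s) (hr s)

theorem finiteAdhesion_treeDecomposition (hA : IsExhaustion G A) :
    (treeDecomposition hA).FiniteAdhesion := by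
  have key : ∀ t u : Node G A, u.level = t.level + 1 →
      (t.part.verts ∩ u.part.verts).Finite := by
    intro t u h
    refine (finite_bdry hA u).subset fun x hx => ?_
    rcases hx.2 with hu | hu
    · have := (below_of_mem_part hA hx.1 hu.1).1
      omega
    · exact hu
  intro t u htu
  rcases htu with h | h
  · exact key t u h.1
  · rw [Set.inter_comm]
    exact key u t h.1

theorem Ray.mem_vertsOf {R : Ray G} {X : Set (Sym2 V)} {n : ℕ}
    (h : s(R n, R (n + 1)) ∈ X) : R n ∈ vertsOf X := ⟨_, h, by simp⟩

/-- The vertices of the separation lie in the component or its finite boundary, which a tail of the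
ray avoids. Conversely, every edge with an end in the component lies in a part above. -/
theorem livesIn_separation_up (hA : IsExhaustion G A) (d : (nodeTree G A).Dart)
    (hd : d.snd.level = d.fst.level + 1) (ω : VertexEnd G) :
    ω.LivesIn (vertsOf ((treeDecomposition hA).separation d)) ↔ ω.LivesIn d.snd.set := by
  constructor
  · rintro ⟨R, hR, hRX⟩
    obtain ⟨n, hn⟩ := R.exists_tail (finite_bdry hA d.snd)
    refine (VertexEnd.livesIn_iff (finite_bdry hA d.snd) hR).2 ⟨n, fun m hm => ?_⟩
    obtain ⟨e, ⟨w, hw, he⟩, hme⟩ := hRX m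
    rw [sideOf_up hA d hd] at hw
    have hmw := SimpleGraph.Subgraph.mem_verts_of_mem_edge he hme
    by_contra hmd
    rcases hmw with h | ⟨-, c, hc, hca⟩
    · exact hmd (hw.2 h.1)
    · exact hn m hm ⟨hmd, c, hw.2 hc, hca⟩
  · rintro ⟨R, hR, hRD⟩
    refine ⟨R, hR, fun n => Ray.mem_vertsOf ?_⟩
    obtain ⟨w, hw⟩ := exists_edge_part hA (e := s(R n, R (n + 1))) (R.adj n)
    refine ⟨w, ?_, hw⟩
    rw [sideOf_up hA d hd]
    exact below_of_mem_edgeSet hA hw (by simp) (hRD n)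

theorem livesIn_separation_down (hA : IsExhaustion G A) (d : (nodeTree G A).Dart)
    (hd : d.fst.level = d.snd.level + 1) (ω : VertexEnd G) :
    ω.LivesIn (vertsOf ((treeDecomposition hA).separation d)) ↔ ω.LivesIn d.fst.setᶜ := by
  constructor
  · refine fun h => h.mono ?_
    rintro x ⟨e, ⟨w, hw, he⟩, hx⟩ hxd
    rw [sideOf_down hA d hd] at hw
    exact hw (below_of_mem_edgeSet hA he hx hxd)
  · rintro ⟨R, hR, hRD⟩
    refine ⟨R, hR, fun n => Ray.mem_vertsOf ?_⟩
    obtain ⟨w, hw⟩ := exists_edge_part hA (e := s(R n, R (n + 1))) (R.adj n)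
    refine ⟨w, ?_, hw⟩
    rw [sideOf_down hA d hd]
    intro hdw
    obtain ⟨x, hx, hxw⟩ := exists_mem_of_mem_edgeSet hw
    have := hdw.2 hxw
    rcases Sym2.mem_iff.1 hx with rfl | rfl
    exacts [hRD _ this, hRD _ this]

/-- A vertex end lives in an end of the tree if and only if the two choose the same nodes. -/
theorem livesInEnd_iff (hA : IsExhaustion G A) (ω : VertexEnd G) (τ : VertexEnd (nodeTree G A)) :
    (treeDecomposition hA).LivesInEnd ω τ ↔
      ∀ u : Node G A, ω.LivesIn u.set ↔ τ.LivesIn (upset u) := by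
  constructor
  · intro h u
    rcases hn : u.level with _ | n
    · obtain rfl := eq_root hn
      obtain ⟨R, hR⟩ := ω.exists_ray
      obtain ⟨Q, hQ⟩ := τ.exists_ray
      exact ⟨fun _ => ⟨Q, hQ, fun m => below_root _⟩, fun _ => ⟨R, hR, fun m => trivial⟩⟩
    · obtain ⟨t, ht, htu⟩ := exists_parent hA hn
      have hd : u.level = t.level + 1 := by omega
      let d : (nodeTree G A).Dart := ⟨(t, u), .inl ⟨hd, htu⟩⟩
      have := h d
      rw [sideOf_up hA d hd] at this
      exact (livesIn_separation_up hA d hd ω).symm.trans this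
  · intro h d
    rcases d.adj with hd | hd
    · rw [sideOf_up hA d hd.1]
      exact (livesIn_separation_up hA d hd.1 ω).trans (h _)
    · rw [sideOf_down hA d hd.1]
      refine (livesIn_separation_down hA d hd.1 ω).trans ?_
      rw [VertexEnd.livesIn_compl (finite_bdry hA _),
        VertexEnd.livesIn_compl (finite_bdry_upset hA _), h]

end Decomposition

/-! ### Ends of the tree against topological ends -/

section Display

variable {V : Type u} {G : SimpleGraph V} {A : ℕ → Set V}

open Node

theorem Node.exists_ancestor (hA : IsExhaustion G A) (w : Node G A) {k : ℕ} (h : k ≤ w.level) :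
    ∃ c : Node G A, c.level = k ∧ Below c w := by
  rcases hw : w.level with _ | n
  · exact ⟨w, by omega, .refl w⟩
  · obtain ⟨x, hx⟩ := set_nonempty hw
    obtain ⟨c, hc, hxc⟩ := exists_mem (G := G) (A := A) (x := x) (n := k)
      fun j hj => h.trans (level_le hA hx hj)
    exact ⟨c, hc, .of_mem hA (by omega) hxc hx⟩

theorem exists_livesIn_upset (hA : IsExhaustion G A) (τ : VertexEnd (nodeTree G A)) (n : ℕ) :
    ∃ u : Node G A, u.level = n ∧ τ.LivesIn (upset u) := by
  induction n with
  | zero =>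
    obtain ⟨R, hR⟩ := τ.exists_ray
    exact ⟨root, rfl, R, hR, fun m => below_root _⟩
  | succ n ih =>
    obtain ⟨u, rfl, R, hR, hRu⟩ := ih
    -- Once `u` is no longer visited, the ray stays above a single child `c` of `u`, since the only
    -- way out of `upset c` leads to `u`.
    obtain ⟨k, hk⟩ := R.exists_tail (Set.finite_singleton u)
    have hlt : u.level + 1 ≤ (R k).level := by
      by_contra hlt
      refine hk k le_rfl ?_
      exact ((hRu k).eq_of_level_eq hA (.refl _) (le_antisymm (hRu k).1 (by omega))).symm
    obtain ⟨c, hc, hcR⟩ := exists_ancestor hA (R k) hlt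
    have huc : Below u c := (hRu k).total hA hcR (by omega)
    refine ⟨c, hc, (VertexEnd.livesIn_iff (finite_bdry_upset hA c) hR).2 ⟨k, fun m hm => ?_⟩⟩
    induction m, hm using Nat.le_induction with
    | base => exact hcR
    | succ m hm ih =>
      by_contra hm'
      obtain ⟨-, h1, h2⟩ := eq_of_adj_of_mem_upset hA (R.adj m) ih hm'
      exact hk (m + 1) (by omega) (h2.eq_of_level_eq hA huc (by omega))

theorem below_of_livesIn_upset (hA : IsExhaustion G A) {τ : VertexEnd (nodeTree G A)}
    {t u : Node G A} (ht : τ.LivesIn (upset t)) (hu : τ.LivesIn (upset u))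
    (hl : t.level ≤ u.level) : Below t u := by
  obtain ⟨w, hw, hw'⟩ := ht.inter_nonempty hu (finite_bdry_upset hA u)
  exact Below.total hA hw hw' hl

theorem below_of_livesIn_set (hA : IsExhaustion G A) {ω : VertexEnd G}
    {t u : Node G A} (ht : ω.LivesIn t.set) (hu : ω.LivesIn u.set)
    (hl : t.level ≤ u.level) : Below t u := by
  obtain ⟨x, hx, hx'⟩ := ht.inter_nonempty hu (finite_bdry hA u)
  exact .of_mem hA hl hx hx'

theorem livesInEnd_of_forall_level (hA : IsExhaustion G A) {ω : VertexEnd G}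
    {τ : VertexEnd (nodeTree G A)} (u : ℕ → Node G A) (hu : ∀ n, (u n).level = n)
    (hτ : ∀ n, τ.LivesIn (upset (u n))) (hω : ∀ n, ω.LivesIn (u n).set) :
    (treeDecomposition hA).LivesInEnd ω τ := by
  refine (livesInEnd_iff hA ω τ).2 fun w => ⟨fun h => ?_, fun h => ?_⟩
  · have h1 := below_of_livesIn_set hA h (hω w.level) (hu _).ge
    have h2 := below_of_livesIn_set hA (hω w.level) h (hu _).le
    rw [h1.antisymm h2]
    exact hτ _
  · have h1 := below_of_livesIn_upset hA h (hτ w.level) (hu _).ge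
    have h2 := below_of_livesIn_upset hA (hτ w.level) h (hu _).le
    rw [h1.antisymm h2]
    exact hω _

/-- The offset is two because `A (k + 1)` contains `x` and all its neighbours, while a component of
level at least `k + 2` avoids `A (k + 1)`. -/
theorem Node.notMem_of_lt (hA : IsExhaustion G A) (hN : ∀ n, bdry G (A n) ⊆ A (n + 1))
    {x : V} {k : ℕ} (hx : x ∈ A k) {t : Node G A} (ht : k + 2 ≤ t.level) :
    x ∉ t.set ∧ x ∉ bdry G t.set := by
  constructor
  · intro h
    have := level_le hA h hx
    omega
  · rintro ⟨-, c, hc, hcx⟩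
    have hcA : c ∈ A (k + 1) := by
      by_cases h : c ∈ A k
      · exact hA.mono (Nat.le_succ k) h
      · exact hN k ⟨h, x, hx, hcx.symm⟩
    have := level_le hA hc hcA
    omega

/-- An end living in components of all levels is undominated. -/
theorem mem_topologicalEnds_of_livesIn (hA : IsExhaustion G A)
    (hN : ∀ n, bdry G (A n) ⊆ A (n + 1)) {ω : VertexEnd G} (u : ℕ → Node G A)
    (hu : ∀ n, (u n).level = n) (hω : ∀ n, ω.LivesIn (u n).set) : ω ∈ topologicalEnds G := by
  intro x
  obtain ⟨k, hk⟩ := hA.exhaust x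
  obtain ⟨h1, h2⟩ := notMem_of_lt hA hN hk (hu (k + 2)).ge
  exact not_dominates_of_livesIn (finite_bdry hA _) (hω _) h1 h2

theorem eq_of_livesIn (hA : IsExhaustion G A) {ω ω' : VertexEnd G} (u : ℕ → Node G A)
    (hu : ∀ n, (u n).level = n) (hω : ∀ n, ω.LivesIn (u n).set)
    (hω' : ∀ n, ω'.LivesIn (u n).set) : ω = ω' := by
  obtain ⟨R, hR⟩ := ω.exists_ray
  obtain ⟨R', hR'⟩ := ω'.exists_ray
  refine hR.symm.trans ((hR'.of_equivalent ?_))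
  refine Ray.equivalent_iff.2 fun S hS => ?_
  choose k hk using hA.exhaust
  obtain ⟨M, hM⟩ := (hS.image k).bddAbove
  obtain ⟨i, hi⟩ := (VertexEnd.livesIn_iff (finite_bdry hA _) hR).1 (hω (M + 1))
  obtain ⟨j, hj⟩ := (VertexEnd.livesIn_iff (finite_bdry hA _) hR').1 (hω' (M + 1))
  -- Since `S ⊆ A M`, the connected component of level `M + 1` avoids `S` and contains tails of both
  -- rays.
  refine ⟨j, i, (connectedSet (hu (M + 1)) _ (hj j le_rfl) _ (hi i le_rfl)).mono ?_⟩
  intro s hs hsu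
  have h1 := hM (Set.mem_image_of_mem k hs)
  have h2 := level_le hA hsu (hk s)
  have h3 := hu (M + 1)
  omega

/-- A descending sequence of components, one for each level, contains an end. -/
theorem exists_livesIn (hA : IsExhaustion G A) (hN : ∀ n, bdry G (A n) ⊆ A (n + 1))
    (u : ℕ → Node G A) (hu : ∀ n, (u n).level = n) (hmono : ∀ m n, m ≤ n → Below (u m) (u n)) :
    ∃ ω : VertexEnd G, ∀ n, ω.LivesIn (u n).set := by
  choose x hx using fun n => set_nonempty (hu (n + 1))
  have hxm : ∀ n i, i ∉ Set.Iio n → x i ∈ (u n).set := fun n i hi =>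
    (hmono n (i + 1) (by rw [Set.mem_Iio] at hi; omega)).2 (hx i)
  rcases (connectedSet (hu 1)).exists_star_or_comb x fun i => (hmono 1 (i + 1) (by omega)).2 (hx i)
    with ⟨y, -, h⟩ | ⟨R, -, h⟩
  -- A star is impossible: its centre `y` is cut off by the finite boundary of the component of
  -- level `k + 2`, which contains all but finitely many of the `x i`.
  · obtain ⟨k, hk⟩ := hA.exhaust y
    obtain ⟨h1, h2⟩ := notMem_of_lt hA hN hk (hu (k + 2)).ge
    obtain ⟨i, hi, hl⟩ := h _ _ (finite_bdry hA (u (k + 2))) (Set.finite_Iio (k + 2)) h2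
    exact absurd (hl.symm.mem_of_bdry subset_rfl (hxm _ i hi)) h1
  · refine ⟨Quotient.mk (raySetoid G) R, fun n => ?_⟩
    have hfin := finite_bdry hA (u n)
    refine (VertexEnd.livesIn_iff hfin (R := R) rfl).2 ?_
    obtain ⟨m, hm⟩ := R.exists_tail hfin
    obtain ⟨j, i, hi, hl⟩ := h _ _ (hfin.union (R.finite_initial m)) (Set.finite_Iio n)
    have hj : m ≤ j := Ray.le_of_notMem_initial fun h => hl.left (.inr h)
    exact ⟨m, R.tail_mem hm hj (hl.symm.mem_of_bdry Set.subset_union_left (hxm n i hi))⟩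

/-- An end that is not in the closure of `A n` lives in a component of `G - A n`. -/
theorem exists_livesIn_of_not_clings (hA : IsExhaustion G A) {ω : VertexEnd G} {R : Ray G}
    (hR : R.BelongsTo ω) (h : ∀ n, ¬ R.Clings (A n)) (n : ℕ) :
    ∃ u : Node G A, u.level = n ∧ ω.LivesIn u.set := by
  cases n with
  | zero => exact ⟨root, rfl, R, hR, fun _ => trivial⟩
  | succ n =>
    obtain ⟨S, -, k, hk, hS⟩ := Ray.not_clings_iff.1 (h n)
    have hkA : ∀ m, k ≤ m → R m ∉ A n := fun m hm hmA =>
      hS m hm (R m) hmA (.refl (hk m hm))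
    let u : Node G A := ⟨(n + 1, comp G (A n) (R k)), R k, hkA k le_rfl, rfl⟩
    exact ⟨u, rfl, (VertexEnd.livesIn_iff (finite_bdry hA u) hR).2
      ⟨k, fun m hm => Ray.linked_of_tail hkA le_rfl hm⟩⟩

theorem endsDefinePrecisely_treeDecomposition (hA : IsExhaustion G A)
    (hN : ∀ n, bdry G (A n) ⊆ A (n + 1))
    (hcl : ∀ ω ∈ topologicalEnds G, ∀ R : Ray G, R.BelongsTo ω → ∀ n, ¬ R.Clings (A n)) :
    (treeDecomposition hA).EndsDefinePrecisely (topologicalEnds G) := by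
  refine ⟨fun τ => ?_, fun ω hω => ?_⟩
  · choose u hu hτ using exists_livesIn_upset hA τ
    have hmono : ∀ m n, m ≤ n → Below (u m) (u n) := fun m n h =>
      below_of_livesIn_upset hA (hτ m) (hτ n) (by rw [hu, hu]; exact h)
    have hlive : ∀ ω : VertexEnd G, (treeDecomposition hA).LivesInEnd ω τ →
        ∀ n, ω.LivesIn (u n).set := fun ω hω n => ((livesInEnd_iff hA ω τ).1 hω _).2 (hτ n)
    obtain ⟨ω, hω⟩ := exists_livesIn hA hN u hu hmono
    exact ⟨⟨ω, livesInEnd_of_forall_level hA u hu hτ hω,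
        fun ω' hω' => eq_of_livesIn hA u hu (hlive ω' hω') hω⟩,
      fun ω' hω' => mem_topologicalEnds_of_livesIn hA hN u hu (hlive ω' hω')⟩
  · obtain ⟨R, hR⟩ := ω.exists_ray
    choose u hu hlive using exists_livesIn_of_not_clings hA hR (hcl ω hω R hR)
    have hmono : ∀ m n, m ≤ n → Below (u m) (u n) := fun m n h =>
      below_of_livesIn_set hA (hlive m) (hlive n) (by rw [hu, hu]; exact h)
    let Q : Ray (nodeTree G A) :=
      { toFun := u
        injective := fun m n h => by rw [← hu m, ← hu n, h]
        adj := fun n => .inl ⟨by rw [hu, hu], hmono n (n + 1) (Nat.le_succ n)⟩ }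
    refine ⟨Quotient.mk (raySetoid _) Q, livesInEnd_of_forall_level hA u hu (fun n => ?_) hlive⟩
    exact (VertexEnd.livesIn_iff (finite_bdry_upset hA _) (R := Q) rfl).2
      ⟨n, fun m hm => hmono n m hm⟩

/-! ### Construction of the exhaustion -/

/-- One vertex from each component of `G`. -/
def representatives (G : SimpleGraph V) : Set V :=
  Set.range fun c : G.ConnectedComponent => c.out

theorem exists_representative (x : V) : ∃ r ∈ representatives G, G.Reachable r x :=
  ⟨_, ⟨G.connectedComponentMk x, rfl⟩,
    SimpleGraph.ConnectedComponent.exact (Quot.out_eq (G.connectedComponentMk x))⟩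

theorem eq_of_reachable_representatives {r r' : V} (hr : r ∈ representatives G)
    (hr' : r' ∈ representatives G) (h : G.Reachable r r') : r = r' := by
  obtain ⟨c, rfl⟩ := hr
  obtain ⟨c', rfl⟩ := hr'
  have h' : c = c' :=
    (Quot.out_eq c).symm.trans ((SimpleGraph.ConnectedComponent.sound h).trans (Quot.out_eq c'))
  rw [h']

/-- A ray stays in one component of `G` and so could cling only to its single representative, which
would then dominate the end. -/
theorem not_clings_representatives {ω : VertexEnd G} (hω : ω ∈ topologicalEnds G) {R : Ray G}
    (hR : R.BelongsTo ω) : ¬ R.Clings (representatives G) := by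
  intro h
  obtain ⟨i, r, hr, p, -⟩ := h ∅ Set.finite_empty
  refine not_clings_singleton_of_not_dominates hR (hω r) fun S hS => ?_
  obtain ⟨j, s, hs, hl⟩ := h S hS
  obtain ⟨q, -⟩ := R.exists_walk_tail 0 i j (Nat.zero_le _) (Nat.zero_le _)
  have hl' := hl
  obtain ⟨q', -⟩ := hl'
  exact ⟨j, r, rfl, eq_of_reachable_representatives hr hs
    ⟨(p.reverse.append q).append q'⟩ ▸ hl⟩

theorem exists_exhaustion (G : SimpleGraph V) : ∃ A : ℕ → Set V, IsExhaustion G A ∧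
    (∀ n, bdry G (A n) ⊆ A (n + 1)) ∧
    ∀ ω ∈ topologicalEnds G, ∀ R : Ray G, R.BelongsTo ω → ∀ n, ¬ R.Clings (A n) := by
  choose E hE hfin hcl using exists_envelope G
  -- The representatives seed every component of `G`, so that adding neighbours repeatedly reaches
  -- every vertex. Starting from `∅` makes the base cases for boundaries and closures trivial.
  let A : ℕ → Set V := fun n => Nat.rec ∅ (fun _ B => E (B ∪ bdry G B ∪ representatives G)) n
  have hsucc : ∀ n, A n ∪ bdry G (A n) ∪ representatives G ⊆ A (n + 1) := fun n => hE _
  have hN : ∀ n, bdry G (A n) ⊆ A (n + 1) := fun n _ hx => hsucc n (.inl (.inr hx))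
  refine ⟨A, ⟨monotone_nat_of_le_succ fun n x hx => hsucc n (.inl (.inl hx)), fun x => ?_,
    fun n x hx => ?_⟩, hN, fun ω hω R hR n => ?_⟩
  · obtain ⟨r, hr, ⟨p⟩⟩ := exists_representative (G := G) x
    have hrA : ∃ n, r ∈ A n := ⟨1, hsucc 0 (.inr hr)⟩
    clear hr
    induction p with
    | nil => exact hrA
    | @cons a b c hab p ih =>
      obtain ⟨n, hn⟩ := hrA
      refine ih ?_
      rcases Classical.em (b ∈ A n) with hb | hb
      · exact ⟨n, hb⟩
      · exact ⟨n + 1, hN n ⟨hb, a, hn, hab⟩⟩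
  · cases n with
    | zero => exact Set.finite_empty.subset (bdry_comp_subset _ _)
    | succ n => exact hfin _ x hx
  · induction n with
    | zero =>
      intro h
      obtain ⟨-, b, hb, -⟩ := h ∅ Set.finite_empty
      exact hb
    | succ n ih =>
      exact fun h => Ray.not_clings_union (Ray.not_clings_union ih (not_clings_bdry hR hω ih))
        (not_clings_representatives hω hR) (hcl _ R h)

end Display

end TopologicalEnds

theorem theorem1 {V : Type u} (G : SimpleGraph V) :
    ∃ (N : Type u) (T : SimpleGraph N) (D : TopologicalEnds.TreeDecomposition G T),
      D.FiniteAdhesion ∧ D.EndsDefinePrecisely (TopologicalEnds.topologicalEnds G) := by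
  obtain ⟨A, hA, hN, hcl⟩ := TopologicalEnds.exists_exhaustion G
  exact ⟨_, _, TopologicalEnds.treeDecomposition hA,
    TopologicalEnds.finiteAdhesion_treeDecomposition hA,
    TopologicalEnds.endsDefinePrecisely_treeDecomposition hA hN hcl⟩
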